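/- Let $n\ge 1$ and let $J^1\mathbb R^n=\{(q,p,z)\}\cong\mathbb R^{2n+1}$ be the 1-jet space with its canonical contact form $\alpha=dz-\sum_i p_i\,dq_i$ and contact structure $\xi=\ker\alpha$. Let $L$ be a smooth $n$-manifold without boundary. A smooth isotopy $\iota\colon L\times[0,1]\hookrightarrow J^1\mathbb R^n$ is a smooth map such that each $\iota_t=\iota(\cdot,t)$ is an embedding that is proper (the intersection of its image with any compact set is compact). It is a Legendrian isotopy if moreover each $\iota_t(L)$ is tangent to $\xi$. It is positive at $p\in L$ if $\alpha(\partial_t\iota(p,t))>0$ for all $t\in[0,1]$, and positive if this holds for every $p\in L$. Let $\iota\colon L\times[0,1]\hookrightarrow J^1\mathbb R^n$ be a Legendrian isotopy that is induced by a path of contactomorphisms, that is, there is a family $(\varphi_t)_{t\in[0,1]}$ of diffeomorphisms of $J^1\mathbb R^n$ preserving $\xi$, smooth as a map $[0,1]\times J^1\mathbb R^n\to J^1\mathbb R^n$, with $\iota_t=\varphi_t\circ\iota_0$ for all $t\in[0,1]$. Suppose that $\iota$ is positive at every point of $L$ outside some compact subset $K\subset L$. Then there is a positive smooth isotopy $\hat\iota\colon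 L\times[0,1]\hookrightarrow J^1\mathbb R^n$ (not necessarily Legendrian) with $\hat\iota_0=\iota_0$ and $\hat\iota_1=\iota_1$, and a compact subset $\hat K\subset L$ such that $\hat\iota(p,t)=\iota(p,t)$ for all $p\in L\setminus\hat K$ and all $t\in[0,1]$. -/

import Mathlib

open Set
open scoped Manifold ContDiff

/-- The 1-jet space `J¹ℝⁿ`: the 1-jet at `q` of a function `u` is `(q, du_q, u q)`.
A point is written `(q, p, z)`, with `q ∈ ℝⁿ`, `p ∈ (ℝⁿ)*` and `z ∈ ℝ`. -/
abbrev JetSpace (n : ℕ) : Type :=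
  EuclideanSpace ℝ (Fin n) × StrongDual ℝ (EuclideanSpace ℝ (Fin n)) × ℝ

namespace JetSpace

/-- The canonical contact form `α = dz - p dq` of `J¹ℝⁿ` at the point `x = (q, p, z)`. -/
noncomputable def contactForm {n : ℕ} (x : JetSpace n) : JetSpace n →L[ℝ] ℝ :=
  (ContinuousLinearMap.snd ℝ (StrongDual ℝ (EuclideanSpace ℝ (Fin n))) ℝ).comp
      (ContinuousLinearMap.snd ℝ (EuclideanSpace ℝ (Fin n))
        (StrongDual ℝ (EuclideanSpace ℝ (Fin n)) × ℝ)) -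
    x.2.1.comp (ContinuousLinearMap.fst ℝ (EuclideanSpace ℝ (Fin n))
      (StrongDual ℝ (EuclideanSpace ℝ (Fin n)) × ℝ))

/-- The value of the contact form: `α_{(q,p,z)} (q', p', z') = z' - p q'`. -/
theorem contactForm_apply {n : ℕ} (x v : JetSpace n) :
    contactForm x v = v.2.2 - x.2.1 v.1 := rfl

/-- The canonical contact distribution `ξ = ker α` of `J¹ℝⁿ`. -/
noncomputable def contactDistribution {n : ℕ} (x : JetSpace n) : Submodule ℝ (JetSpace n) :=
  LinearMap.ker (contactForm x).toLinearMap

/-- The smooth diffeomorphisms of `J¹ℝⁿ`. -/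
abbrev Diff (n : ℕ) : Type :=
  Diffeomorph 𝓘(ℝ, JetSpace n) 𝓘(ℝ, JetSpace n) (JetSpace n) (JetSpace n) ∞

/-- A contactomorphism is a diffeomorphism whose differential maps `ξ_x` onto `ξ_{φ x}`. -/
def IsContactomorphism {n : ℕ} (φ : Diff n) : Prop :=
  ∀ x, (contactDistribution x).map (fderiv ℝ φ x).toLinearMap = contactDistribution (φ x)

/-- `(φ_t)_{t ∈ [0,1]}` is a smooth path of contactomorphisms, i.e. a family of contactomorphisms
that is smooth as a map `[0,1] × J¹ℝⁿ → J¹ℝⁿ` (values at times outside `[0,1]` are irrelevant). -/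
structure IsContactPath {n : ℕ} (φ : ℝ → Diff n) : Prop where
  smooth : ContDiffOn ℝ ∞ (fun x : ℝ × JetSpace n => φ x.1 x.2) (Icc 0 1 ×ˢ univ)
  contacto : ∀ t ∈ Icc (0 : ℝ) 1, IsContactomorphism (φ t)

section Isotopies

variable {n : ℕ} {L : Type*} [TopologicalSpace L] [ChartedSpace (EuclideanSpace ℝ (Fin n)) L]

/-- `(ι_t)_{t ∈ [0,1]}` is a smooth isotopy of the `n`-manifold `L` in `J¹ℝⁿ`: a family of proper
smooth embeddings, smooth as a map `L × [0,1] → J¹ℝⁿ`. Proper means that the intersection of the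
image with any compact set is compact. Values at times outside `[0,1]` are irrelevant. -/
structure IsIsotopy (ι : ℝ → L → JetSpace n) : Prop where
  smooth : ContMDiffOn ((𝓡 n).prod 𝓘(ℝ, ℝ)) 𝓘(ℝ, JetSpace n) ∞
    (fun x : L × ℝ => ι x.2 x.1) (univ ×ˢ Icc 0 1)
  embedding : ∀ t ∈ Icc (0 : ℝ) 1,
    Manifold.IsSmoothEmbedding (𝓡 n) 𝓘(ℝ, JetSpace n) ∞ (ι t)
  proper : ∀ t ∈ Icc (0 : ℝ) 1, ∀ C : Set (JetSpace n), IsCompact C → IsCompact (range (ι t) ∩ C)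

/-- A Legendrian isotopy: a smooth isotopy of the `n`-manifold `L` such that at all times the image
is tangent to `ξ`. -/
structure IsLegendrianIsotopy (ι : ℝ → L → JetSpace n) : Prop extends IsIsotopy ι where
  legendrian : ∀ t ∈ Icc (0 : ℝ) 1, ∀ p : L,
    LinearMap.range (mfderiv (𝓡 n) 𝓘(ℝ, JetSpace n) (ι t) p).toLinearMap ≤
      contactDistribution (ι t p)

/-- The isotopy is positive along the trajectory of `p`: `α (∂_t ι_t p) > 0` for all `t ∈ [0,1]`
(with one-sided derivatives at the endpoints). -/
def PositiveAt {L : Type*} (ι : ℝ → L → JetSpace n) (p : L) : Prop :=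
  ∀ t ∈ Icc (0 : ℝ) 1, 0 < contactForm (ι t p) (derivWithin (fun s => ι s p) (Icc 0 1) t)

/-- The isotopy is induced by a smooth path of contactomorphisms: `ι_t = φ_t ∘ ι_0`. -/
def IsInducedByContactPath {L : Type*} (ι : ℝ → L → JetSpace n) : Prop :=
  ∃ φ : ℝ → Diff n, IsContactPath φ ∧ ∀ t ∈ Icc (0 : ℝ) 1, ∀ p, ι t p = φ t (ι 0 p)

end Isotopies

end JetSpace

open scoped NNReal Topology

/-! Write `ι t = φ t ∘ ι 0` and take `φ t ∘ Θ t ∘ ι 0`, where `Θ` is a loop of compactly supported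
diffeomorphisms based at the identity. These need not be contact, which is why the result need not
be Legendrian. Since `φ t` pulls `α` back to `g α` with `g` nowhere zero, the chain rule gives speed
`H + g · α(∂_t Θ)`, both `H` (the Hamiltonian) and `g` taken at the displaced point. The loop turns
`N` times around a circle of radius about `ε` in a `(q, p)`-plane, with a lift to `z` giving the
constant `α`-speed `±ε²κ/2`, where `κ = 2πN`. Displacement and Lipschitz constant are `O(ε)`
uniformly in `κ`, so a small `ε` and a large `κ` give any prescribed speed while each `Θ t` stays
close to the identity (`exists_spiral_bound`, `contactForm_deriv_spiral`). `exists_loop` combines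
this with a cutoff `χ`. -/

/-! ### Embeddings, diffeomorphisms near the identity, Lipschitz bounds. -/

theorem Manifold.IsSmoothEmbedding.diffeomorph_comp
    {E H M F G N : Type*} [NormedAddCommGroup E] [NormedSpace ℝ E]
    [NormedAddCommGroup F] [NormedSpace ℝ F] [TopologicalSpace H] [TopologicalSpace G]
    {I : ModelWithCorners ℝ E H} {J : ModelWithCorners ℝ F G}
    [TopologicalSpace M] [ChartedSpace H M] [TopologicalSpace N] [ChartedSpace G N]
    {k : ℕ∞ω} [IsManifold J k N] {f : M → N}
    (hf : Manifold.IsSmoothEmbedding I J k f) (Φ : Diffeomorph J J N N k) :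
    Manifold.IsSmoothEmbedding I J k (fun x => Φ (f x)) := by
  refine ⟨?_, Φ.toHomeomorph.isEmbedding.comp hf.isEmbedding⟩
  obtain ⟨C, _, _, h⟩ := hf.isImmersion
  refine ⟨C, inferInstance, inferInstance, fun x => ?_⟩
  have hx := h x
  -- Precomposing the target chart with `Φ⁻¹` leaves the local normal form of `f` unchanged.
  refine Manifold.IsImmersionAtOfComplement.mk_of_charts hx.equiv hx.domChart
    (Φ.symm.toHomeomorph.toOpenPartialHomeomorph.trans hx.codChart) hx.mem_domChart_source
    (by simpa using hx.mem_codChart_source) hx.domChart_mem_maximalAtlas ?_ ?_ ?_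
  · apply OpenPartialHomeomorph.mem_maximalAtlas_of_contMDiffOn
    · have h1 := contMDiffOn_of_mem_maximalAtlas hx.codChart_mem_maximalAtlas
      refine h1.comp (Φ.symm.contMDiff.contMDiffOn) ?_
      intro y hy
      simpa using hy
    · have h1 := contMDiffOn_symm_of_mem_maximalAtlas hx.codChart_mem_maximalAtlas
      have := (Φ.contMDiff.comp_contMDiffOn h1)
      refine this.mono ?_
      intro y hy
      simpa using hy
  · intro y hy
    simpa using hx.source_subset_preimage_source hy
  · intro y hy
    simpa using hx.writtenInCharts hy

/-- The identity plus a contraction is a homeomorphism, and its differential `1 + du` is invertible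
by the Neumann series because `‖du‖ ≤ c < 1`; hence the inverse is smooth. -/
theorem exists_diffeomorph_id_add {E : Type*} [NormedAddCommGroup E] [NormedSpace ℝ E]
    [CompleteSpace E] {u : E → E} (hu : ContDiff ℝ ∞ u) {c : ℝ≥0} (hc : c < 1)
    (hl : LipschitzWith c u) :
    ∃ Ψ : Diffeomorph 𝓘(ℝ, E) 𝓘(ℝ, E) E E ∞, ∀ x, Ψ x = x + u x := by
  have happ : ApproximatesLinearOn (fun x => x + u x)
      ((ContinuousLinearEquiv.refl ℝ E : E ≃L[ℝ] E) : E →L[ℝ] E) univ c := by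
    intro x _ y _
    have := hl.norm_sub_le x y
    have h : x + u x - (y + u y) - (x - y) = u x - u y := by abel
    simpa [h] using this
  have hc' : Subsingleton E ∨
      c < ‖((ContinuousLinearEquiv.refl ℝ E).symm : E →L[ℝ] E)‖₊⁻¹ := by
    rcases subsingleton_or_nontrivial E with h | h
    · exact Or.inl h
    · right
      have : ‖((ContinuousLinearEquiv.refl ℝ E).symm : E →L[ℝ] E)‖₊ = 1 := by
        ext
        simp
      rw [this]
      simpa using hc
  let Θ : E ≃ₜ E := happ.toHomeomorph _ hc'
  have hΘ : ∀ x, Θ x = x + u x := fun x => rfl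
  have hsm : ContDiff ℝ ∞ Θ := contDiff_id.add hu
  have hd : ∀ a, ‖-fderiv ℝ u a‖ < 1 := fun a => by
    rw [norm_neg]
    exact (norm_fderiv_le_of_lipschitz ℝ hl).trans_lt (by exact_mod_cast hc)
  have hsymm : ContDiff ℝ ∞ Θ.symm := by
    refine Θ.contDiff_symm (f₀' := fun a =>
      ContinuousLinearEquiv.unitsEquiv ℝ E (Units.oneSub (-fderiv ℝ u a) (hd a))) ?_ hsm
    intro a
    have h1 : HasFDerivAt u (fderiv ℝ u a) a :=
      (hu.differentiable (by simp)).differentiableAt.hasFDerivAt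
    refine ((hasFDerivAt_id a).add h1).congr_fderiv ?_
    ext v
    simp [ContinuousLinearEquiv.unitsEquiv_apply]
  exact ⟨⟨Θ.toEquiv, hsm.contMDiff, hsymm.contMDiff⟩, hΘ⟩

theorem ContDiff.exists_lipschitzWith_and_norm_le {E F : Type*}
    [NormedAddCommGroup E] [NormedSpace ℝ E] [NormedAddCommGroup F] [NormedSpace ℝ F]
    {V : E → F} (hV : ContDiff ℝ ∞ V) (hc : HasCompactSupport V) :
    ∃ M : ℝ≥0, LipschitzWith M V ∧ ∀ x, ‖V x‖ ≤ M := by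
  obtain ⟨A, hA⟩ := ContDiff.lipschitzWith_of_hasCompactSupport hc hV (by simp)
  obtain ⟨B, hB⟩ := hc.exists_bound_of_continuous hV.continuous
  refine ⟨max A B.toNNReal, hA.weaken (le_max_left _ _), fun x => (hB x).trans ?_⟩
  exact (Real.le_coe_toNNReal B).trans (by exact_mod_cast le_max_right _ _)

/-! ### The spiral loop and its estimates. -/

namespace JetSpace

variable {n : ℕ}

/-- At time `t` the point `(q, p, z)` is moved by `ε χ` times a loop in the plane spanned by
`e` and `ℓ`, with a vertical correction for which the contact form is constant in time. -/
noncomputable def spiral (e : EuclideanSpace ℝ (Fin n)) (ℓ : StrongDual ℝ (EuclideanSpace ℝ (Fin n)))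
    (χ : JetSpace n → ℝ) (σ ε κ t : ℝ) (x : JetSpace n) : JetSpace n :=
  (σ * ε * (Real.cos (κ * t) - 1)) • (χ x • ((e, 0, x.2.1 e) : JetSpace n)) +
  (ε * Real.sin (κ * t)) • (χ x • ((0, ℓ, 0) : JetSpace n)) +
  (σ * ε ^ 2 * Real.sin (2 * (κ * t)) / 4) • (χ x ^ 2 • ((0, 0, 1) : JetSpace n))

variable {e : EuclideanSpace ℝ (Fin n)} {ℓ : StrongDual ℝ (EuclideanSpace ℝ (Fin n))}
  {χ : JetSpace n → ℝ} {σ ε κ t : ℝ}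

theorem spiral_eq_zero {x : JetSpace n} (hx : χ x = 0) : spiral e ℓ χ σ ε κ t x = 0 := by
  simp [spiral, hx]

theorem spiral_int_mul_two_pi {N : ℕ} {x : JetSpace n} (h : κ * t = N * (2 * Real.pi)) :
    spiral e ℓ χ σ ε κ t x = 0 := by
  have h1 : Real.cos (κ * t) = 1 := by rw [h]; exact Real.cos_nat_mul_two_pi N
  have h2 : Real.sin (κ * t) = 0 := by
    rw [h, show (N : ℝ) * (2 * Real.pi) = ((2 * N : ℕ) : ℝ) * Real.pi by push_cast; ring]
    exact Real.sin_nat_mul_pi _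
  simp [spiral, Real.sin_two_mul, h1, h2]

theorem contDiff_spiral (hχ : ContDiff ℝ ∞ χ) :
    ContDiff ℝ ∞ (fun y : ℝ × JetSpace n => spiral e ℓ χ σ ε κ y.1 y.2) := by
  have h1 : ContDiff ℝ ∞ (fun y : ℝ × JetSpace n => χ y.2) := hχ.comp contDiff_snd
  have h2 : ContDiff ℝ ∞ (fun y : ℝ × JetSpace n => y.2.2.1 e) := by fun_prop
  have h3 : ContDiff ℝ ∞ (fun y : ℝ × JetSpace n => ((e, 0, y.2.2.1 e) : JetSpace n)) :=
    contDiff_const.prodMk (contDiff_const.prodMk h2)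
  unfold spiral
  fun_prop

theorem hasDerivAt_spiral (x : JetSpace n) : HasDerivAt (fun s => spiral e ℓ χ σ ε κ s x)
    ((-σ * ε * κ * Real.sin (κ * t)) • (χ x • ((e, 0, x.2.1 e) : JetSpace n)) +
      (ε * κ * Real.cos (κ * t)) • (χ x • ((0, ℓ, 0) : JetSpace n)) +
      (σ * ε ^ 2 * κ * Real.cos (2 * (κ * t)) / 2) • (χ x ^ 2 • ((0, 0, 1) : JetSpace n))) t := by
  have h0 : HasDerivAt (fun s : ℝ => κ * s) κ t := by
    simpa using (hasDerivAt_id t).const_mul κ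
  have h1 := ((h0.cos.sub_const 1).const_mul (σ * ε)).smul_const
    (χ x • ((e, 0, x.2.1 e) : JetSpace n))
  have h2 := (h0.sin.const_mul ε).smul_const (χ x • ((0, ℓ, 0) : JetSpace n))
  have h3 := (((h0.const_mul 2).sin.const_mul (σ * ε ^ 2)).div_const 4).smul_const
    (χ x ^ 2 • ((0, 0, 1) : JetSpace n))
  refine ((h1.add h2).add h3).congr_deriv ?_
  congr 1
  · congr 1
    · congr 1; ring
    · congr 1; ring
  · congr 1; ring

/-- The `p(e)` terms cancel, and the rest is constant because `cos 2θ / 2 + sin² θ = 1/2`. -/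
theorem contactForm_deriv_spiral (hℓ : ℓ e = 1) (x : JetSpace n) :
    contactForm (x + spiral e ℓ χ σ ε κ t x) (deriv (fun s => spiral e ℓ χ σ ε κ s x) t) =
      σ * (ε ^ 2 * κ / 2 * χ x ^ 2) := by
  rw [(hasDerivAt_spiral x).deriv, contactForm_apply]
  simp [spiral, hℓ]
  rw [Real.cos_two_mul, Real.cos_sq']
  ring

/-- The point is that `M` depends on neither `κ` nor `t`: these enter only through bounded
trigonometric coefficients of three fixed compactly supported fields. -/
theorem exists_spiral_bound (e : EuclideanSpace ℝ (Fin n))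
    (ℓ : StrongDual ℝ (EuclideanSpace ℝ (Fin n))) (hχ : ContDiff ℝ ∞ χ)
    (hc : HasCompactSupport χ) (hσ : |σ| ≤ 1) :
    ∃ M : ℝ≥0, ∀ ε : ℝ≥0, ε ≤ 1 → ∀ κ t : ℝ,
      LipschitzWith (ε * M) (spiral e ℓ χ σ ε κ t) ∧
        ∀ x, ‖spiral e ℓ χ σ ε κ t x‖ ≤ ε * M := by
  have h2 : ContDiff ℝ ∞ (fun y : JetSpace n => y.2.1 e) := by fun_prop
  have h3 : ContDiff ℝ ∞ (fun y : JetSpace n => ((e, 0, y.2.1 e) : JetSpace n)) :=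
    contDiff_const.prodMk (contDiff_const.prodMk h2)
  obtain ⟨A, hA, hA'⟩ := (hχ.smul h3).exists_lipschitzWith_and_norm_le hc.smul_right
  obtain ⟨B, hB, hB'⟩ := (hχ.smul (contDiff_const (c := ((0, ℓ, 0) : JetSpace n)))
    ).exists_lipschitzWith_and_norm_le hc.smul_right
  obtain ⟨C, hC, hC'⟩ := ((hχ.pow 2).smul (contDiff_const (c := ((0, 0, 1) : JetSpace n)))
    ).exists_lipschitzWith_and_norm_le
      (HasCompactSupport.smul_right (f := fun x => χ x ^ 2)
        (hc.comp_left (g := fun r : ℝ => r ^ 2) (by simp)))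
  refine ⟨2 * A + B + C, fun ε hε κ t => ?_⟩
  have k1 : ‖σ * ε * (Real.cos (κ * t) - 1)‖ ≤ ε * 2 := by
    rw [norm_mul, norm_mul, Real.norm_eq_abs, Real.norm_eq_abs, Real.norm_eq_abs,
      abs_of_nonneg ε.coe_nonneg]
    have : |Real.cos (κ * t) - 1| ≤ 2 := by
      rw [abs_le]; constructor <;> linarith [Real.cos_le_one (κ * t), Real.neg_one_le_cos (κ * t)]
    have h : |σ| * (ε : ℝ) ≤ 1 * ε := by gcongr
    calc _ ≤ (1 * (ε : ℝ)) * 2 := by gcongr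
      _ = _ := by ring
  have k2 : ‖ε * Real.sin (κ * t)‖ ≤ ε := by
    rw [norm_mul, Real.norm_eq_abs, Real.norm_eq_abs, abs_of_nonneg ε.coe_nonneg]
    calc _ ≤ (ε : ℝ) * 1 := by gcongr; exact Real.abs_sin_le_one _
      _ = _ := by ring
  have k3 : ‖σ * (ε : ℝ) ^ 2 * Real.sin (2 * (κ * t)) / 4‖ ≤ ε := by
    rw [norm_div, norm_mul, norm_mul, Real.norm_eq_abs, Real.norm_eq_abs, Real.norm_eq_abs,
      abs_of_nonneg (sq_nonneg (ε : ℝ))]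
    have hε' : (ε : ℝ) ≤ 1 := by exact_mod_cast hε
    have h := Real.abs_sin_le_one (2 * (κ * t))
    have h4 : (ε : ℝ) ^ 2 ≤ ε := by nlinarith [ε.coe_nonneg]
    calc _ ≤ 1 * (ε : ℝ) * 1 / ‖(4 : ℝ)‖ := by gcongr
      _ ≤ _ := by norm_num; linarith [ε.coe_nonneg]
  constructor
  · refine LipschitzWith.of_dist_le_mul fun x y => ?_
    have a := hA.norm_sub_le x y
    have b := hB.norm_sub_le x y
    have c := hC.norm_sub_le x y
    rw [dist_eq_norm, dist_eq_norm]
    have : spiral e ℓ χ σ ε κ t x - spiral e ℓ χ σ ε κ t y =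
        (σ * ε * (Real.cos (κ * t) - 1)) • (χ x • ((e, 0, x.2.1 e) : JetSpace n) -
            χ y • ((e, 0, y.2.1 e) : JetSpace n)) +
          (ε * Real.sin (κ * t)) •
            (χ x • ((0, ℓ, 0) : JetSpace n) - χ y • ((0, ℓ, 0) : JetSpace n)) +
          (σ * ε ^ 2 * Real.sin (2 * (κ * t)) / 4) •
            (χ x ^ 2 • ((0, 0, 1) : JetSpace n) - χ y ^ 2 • ((0, 0, 1) : JetSpace n)) := by
      simp only [spiral, smul_sub]
      abel
    rw [this]
    calc _ ≤ (ε : ℝ) * 2 * (A * ‖x - y‖) + ε * (B * ‖x - y‖) + ε * (C * ‖x - y‖) :=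
          norm_add₃_le.trans (add_le_add (add_le_add
            ((norm_smul_le _ _).trans (mul_le_mul k1 a (norm_nonneg _) (by positivity)))
            ((norm_smul_le _ _).trans (mul_le_mul k2 b (norm_nonneg _) (by positivity))))
            ((norm_smul_le _ _).trans (mul_le_mul k3 c (norm_nonneg _) (by positivity))))
      _ = _ := by push_cast; ring
  · intro x
    calc _ ≤ (ε : ℝ) * 2 * A + ε * B + ε * C :=
          norm_add₃_le.trans (add_le_add (add_le_add
            ((norm_smul_le _ _).trans (mul_le_mul k1 (hA' x) (norm_nonneg _) (by positivity)))
            ((norm_smul_le _ _).trans (mul_le_mul k2 (hB' x) (norm_nonneg _) (by positivity))))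
            ((norm_smul_le _ _).trans (mul_le_mul k3 (hC' x) (norm_nonneg _) (by positivity))))
      _ = _ := by push_cast; ring

/-! ### Contact Hamiltonian and conformal factor of a contact path. -/

/-- The differential at `(t, x)` of the map `[0,1] × J¹ℝⁿ → J¹ℝⁿ` given by a path of
diffeomorphisms. -/
noncomputable def pathDeriv (φ : ℝ → Diff n) (y : ℝ × JetSpace n) :
    ℝ × JetSpace n →L[ℝ] JetSpace n :=
  fderivWithin ℝ (fun x : ℝ × JetSpace n => φ x.1 x.2) (Icc 0 1 ×ˢ univ) y

/-- The contact Hamiltonian of a path of diffeomorphisms, pulled back: `α (∂_t φ_t x)`. -/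
noncomputable def pathHamiltonian (φ : ℝ → Diff n) (y : ℝ × JetSpace n) : ℝ :=
  contactForm (φ y.1 y.2) (pathDeriv φ y (1, 0))

/-- The factor `g` in `φ_t^* α = g α`, for a path of contactomorphisms. -/
noncomputable def conformalFactor (φ : ℝ → Diff n) (y : ℝ × JetSpace n) : ℝ :=
  contactForm (φ y.1 y.2) (pathDeriv φ y (0, (0, 0, 1)))

theorem uniqueDiffOn_time : UniqueDiffOn ℝ (Icc (0 : ℝ) 1 ×ˢ (univ : Set (JetSpace n))) :=
  (uniqueDiffOn_Icc zero_lt_one).prod uniqueDiffOn_univ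

namespace IsContactPath

variable {φ : ℝ → Diff n}

theorem continuousOn_contactForm (hφ : IsContactPath φ) (v : ℝ × JetSpace n) :
    ContinuousOn (fun y => contactForm (φ y.1 y.2) (pathDeriv φ y v)) (Icc 0 1 ×ˢ univ) := by
  have h1 : ContinuousOn (fun y => pathDeriv φ y v) (Icc 0 1 ×ˢ univ) :=
    (hφ.smooth.continuousOn_fderivWithin uniqueDiffOn_time (by simp)).clm_apply continuousOn_const
  have h2 := hφ.smooth.continuousOn
  simp only [contactForm_apply]
  exact h1.snd.snd.sub (h2.snd.fst.clm_apply h1.fst)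

theorem hasFDerivWithinAt (hφ : IsContactPath φ) {y : ℝ × JetSpace n} (ht : y.1 ∈ Icc (0 : ℝ) 1) :
    HasFDerivWithinAt (fun x : ℝ × JetSpace n => φ x.1 x.2) (pathDeriv φ y)
      (Icc 0 1 ×ˢ univ) y :=
  (hφ.smooth.differentiableOn (by simp) y ⟨ht, mem_univ _⟩).hasFDerivWithinAt

theorem hasFDerivAt (hφ : IsContactPath φ) {t : ℝ} (ht : t ∈ Icc (0 : ℝ) 1) (x : JetSpace n) :
    HasFDerivAt (φ t) ((pathDeriv φ (t, x)).comp (ContinuousLinearMap.inr ℝ ℝ (JetSpace n))) x := by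
  have h := hφ.hasFDerivWithinAt (y := (t, x)) ht
  rw [← hasFDerivWithinAt_univ]
  exact h.comp (f := fun x : JetSpace n => (t, x)) x
    (hasFDerivAt_prodMk_right t x).hasFDerivWithinAt (fun z _ => ⟨ht, mem_univ _⟩)

theorem hasDerivWithinAt (hφ : IsContactPath φ) {t : ℝ} (ht : t ∈ Icc (0 : ℝ) 1)
    {c : ℝ → JetSpace n} {c' : JetSpace n} (hc : HasDerivAt c c' t) :
    HasDerivWithinAt (fun s => φ s (c s)) (pathDeriv φ (t, c t) (1, c')) (Icc 0 1) t :=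
  HasFDerivWithinAt.comp_hasDerivWithinAt (f := fun s => (s, c s)) t
    (hφ.hasFDerivWithinAt (y := (t, c t)) ht)
    ((hasDerivAt_id t).prodMk hc).hasDerivWithinAt (fun _ hs => ⟨hs, mem_univ _⟩)

/-- The vector `v - α(v) ∂_z` lies in `ξ`, which the differential of `φ t` preserves, so only `α(v)
∂_z` contributes. -/
theorem contactForm_pathDeriv_inr (hφ : IsContactPath φ) {t : ℝ} (ht : t ∈ Icc (0 : ℝ) 1)
    (x v : JetSpace n) :
    contactForm (φ t x) (pathDeriv φ (t, x) (0, v)) =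
      conformalFactor φ (t, x) * contactForm x v := by
  set r := contactForm x v with hr
  have hk : v - r • ((0, 0, 1) : JetSpace n) ∈ contactDistribution x := by
    simp [contactDistribution, LinearMap.mem_ker, contactForm_apply, hr]
  have hm := hφ.contacto t ht x ▸ Submodule.mem_map_of_mem hk
    (f := (fderiv ℝ (φ t) x).toLinearMap)
  have hm' : contactForm (φ t x) (fderiv ℝ (φ t) x (v - r • ((0, 0, 1) : JetSpace n))) = 0 := hm
  rw [(hφ.hasFDerivAt ht x).fderiv] at hm'
  simp only [map_sub, map_smul, ContinuousLinearMap.comp_apply,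
    ContinuousLinearMap.inr_apply] at hm'
  rw [sub_eq_zero] at hm'
  rw [hm', conformalFactor, smul_eq_mul, mul_comm]

/-- If the factor vanished, the differential would take values in `ξ`; but it is onto, so it hits
`∂_z`, where `α = 1`. -/
theorem conformalFactor_ne_zero (hφ : IsContactPath φ) {t : ℝ} (ht : t ∈ Icc (0 : ℝ) 1)
    (x : JetSpace n) : conformalFactor φ (t, x) ≠ 0 := by
  intro h0
  have h1 := hφ.hasFDerivAt ht x
  have h2 : HasFDerivAt (φ t).symm (fderiv ℝ (φ t).symm (φ t x)) (φ t x) :=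
    ((φ t).symm.contMDiff.contDiff.differentiable (by simp)).differentiableAt.hasFDerivAt
  rw [← (φ t).symm_apply_apply x] at h1
  have h3 := h1.comp (φ t x) h2
  have h4 : (φ t) ∘ (φ t).symm = id := by ext1 z; simp
  rw [h4] at h3
  have h5 := congrArg (fun A => A ((0, 0, 1) : JetSpace n)) (h3.unique (hasFDerivAt_id _))
  simp only [ContinuousLinearMap.comp_apply, ContinuousLinearMap.inr_apply,
    Diffeomorph.symm_apply_apply, ContinuousLinearMap.id_apply] at h5
  have h6 := hφ.contactForm_pathDeriv_inr ht x
    (fderiv ℝ (φ t).symm (φ t x) ((0, 0, 1) : JetSpace n))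
  rw [h5, h0, contactForm_apply] at h6
  simp at h6

/-- A continuous nonvanishing function on the connected set `[0,1] × J¹ℝⁿ` has constant sign. This
`σ` fixes the direction in which the loop turns. -/
theorem exists_sign_conformalFactor (hφ : IsContactPath φ) :
    ∃ σ : ℝ, |σ| = 1 ∧ ∀ y ∈ Icc (0 : ℝ) 1 ×ˢ (univ : Set (JetSpace n)),
      0 < σ * conformalFactor φ y := by
  have hc : IsPreconnected (Icc (0 : ℝ) 1 ×ˢ (univ : Set (JetSpace n))) :=
    isPreconnected_Icc.prod isPreconnected_univ
  have hne : ∀ y ∈ Icc (0 : ℝ) 1 ×ˢ (univ : Set (JetSpace n)), conformalFactor φ y ≠ 0 :=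
    fun y hy => hφ.conformalFactor_ne_zero hy.1 y.2
  by_cases h : ∀ y ∈ Icc (0 : ℝ) 1 ×ˢ (univ : Set (JetSpace n)), 0 < conformalFactor φ y
  · exact ⟨1, by simp, by simpa using h⟩
  · push Not at h
    obtain ⟨y, hy, hy0⟩ := h
    refine ⟨-1, by simp, fun z hz => ?_⟩
    by_contra! hz0
    obtain ⟨w, hw, hw0⟩ := hc.intermediate_value hy hz
      (hφ.continuousOn_contactForm (0, (0, 0, 1))) (show (0 : ℝ) ∈ Icc _ _ from
        ⟨hy0, by
        change 0 ≤ conformalFactor φ z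
        linarith⟩)
    exact hne w hw hw0

/-! ### Construction of the correcting loop. -/

/-- A path of contactomorphisms that is positive along `A \ K` becomes positive along `A` after
precomposition with a suitable loop of compactly supported diffeomorphisms. -/
theorem exists_loop (hφ : IsContactPath φ) (hn : 1 ≤ n) {A K : Set (JetSpace n)}
    (hA : ∀ C : Set (JetSpace n), IsCompact C → IsCompact (A ∩ C)) (hK : IsCompact K)
    (hpos : ∀ x ∈ A, x ∉ K → ∀ t ∈ Icc (0 : ℝ) 1, 0 < pathHamiltonian φ (t, x)) :
    ∃ Θ : ℝ → Diff n, ContDiff ℝ ∞ (fun y : ℝ × JetSpace n => Θ y.1 y.2) ∧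
      (∀ x, Θ 0 x = x) ∧ (∀ x, Θ 1 x = x) ∧
      (∃ C : Set (JetSpace n), IsCompact C ∧ ∀ t, ∀ x ∉ C, Θ t x = x) ∧
      ∀ x ∈ A, ∀ t ∈ Icc (0 : ℝ) 1, 0 < contactForm (φ t (Θ t x))
        (derivWithin (fun s => φ s (Θ s x)) (Icc 0 1) t) := by
  obtain ⟨R, hR0, hR⟩ := hK.isBounded.subset_ball_lt 0 (0 : JetSpace n)
  let χ : ContDiffBump (0 : JetSpace n) := ⟨R, R + 1, hR0, by linarith⟩
  obtain ⟨σ, hσ, hg⟩ := hφ.exists_sign_conformalFactor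
  let e : EuclideanSpace ℝ (Fin n) := EuclideanSpace.single ⟨0, hn⟩ 1
  let ℓ : StrongDual ℝ (EuclideanSpace ℝ (Fin n)) := innerSL ℝ e
  have hℓ : ℓ e = 1 := by simp [ℓ, e]
  obtain ⟨M, hM⟩ := exists_spiral_bound e ℓ (χ := χ) χ.contDiff χ.hasCompactSupport hσ.le
  have hh := hφ.continuousOn_contactForm (1, 0)
  -- The transition shell of `χ`, where the loop may be too slow to help: there `H > 0` on `A`, and
  -- compactness gives a margin `δ` for displaced points.
  have hQ : IsCompact (A ∩ (Metric.closedBall 0 (R + 1) \ Metric.ball 0 R)) :=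
    hA _ ((isCompact_closedBall _ _).diff Metric.isOpen_ball)
  -- Projecting time to `[0,1]` extends `H` continuously, so that its positivity set is open in the
  -- whole space.
  let clamp : ℝ × JetSpace n → ℝ × JetSpace n := fun y => (projIcc 0 1 zero_le_one y.1, y.2)
  have hclamp : Continuous clamp := by fun_prop
  have hopen : IsOpen {y | 0 < pathHamiltonian φ (clamp y)} :=
    isOpen_lt continuous_const
      (hh.comp_continuous hclamp fun y => ⟨(projIcc 0 1 zero_le_one y.1).2, mem_univ _⟩)
  have hclamp' : ∀ t ∈ Icc (0 : ℝ) 1, ∀ x : JetSpace n, clamp (t, x) = (t, x) := by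
    intro t ht x
    simp [clamp, projIcc_of_mem zero_le_one ht]
  obtain ⟨δ, hδ, hδ'⟩ := ((isCompact_Icc (a := (0 : ℝ)) (b := 1)).prod hQ
    ).exists_thickening_subset_open hopen (by
      rintro ⟨t, x⟩ ⟨ht, hxA, hx⟩
      have : 0 < pathHamiltonian φ (clamp (t, x)) := by
        rw [hclamp' t ht]
        exact hpos x hxA (fun hxK => hx.2 (hR hxK)) t ht
      exact this)
  -- The radius `R + 2` leaves room for displacements smaller than 1 from the support of `χ`.
  obtain ⟨T, hT⟩ := ((isCompact_Icc (a := (0 : ℝ)) (b := 1)).prod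
    (isCompact_closedBall (0 : JetSpace n) (R + 2))).exists_bound_of_continuousOn
    (f := fun y => pathHamiltonian φ y / (σ * conformalFactor φ y)) (by
      refine ContinuousOn.div (hh.mono (prod_mono_right (subset_univ _)))
        (continuousOn_const.mul ((hφ.continuousOn_contactForm (0, (0, 0, 1))).mono
          (prod_mono_right (subset_univ _)))) ?_
      rintro ⟨t, x⟩ ⟨ht, -⟩
      exact (hg (t, x) ⟨ht, mem_univ _⟩).ne')
  have hT0 : 0 < |T| + 1 := by positivity
  have hM0 : (0 : ℝ) ≤ M := M.2
  set η : ℝ := min 1 δ / (M + 1) with hη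
  have hη0 : 0 < η := by positivity
  have hη1 : η ≤ 1 := (div_le_one (by positivity)).2 ((min_le_left _ _).trans (by linarith))
  have hηM : η * M < min 1 δ := by
    have h1 : 0 < min 1 δ := by positivity
    rw [hη, div_mul_eq_mul_div, div_lt_iff₀ (by positivity)]
    nlinarith
  -- With `ε` chosen so that `ε²κ/2 = |T| + 1`, this lower bound on `N` is what yields `ε ≤ η`.
  obtain ⟨N, hN⟩ := exists_nat_gt ((|T| + 1) / (Real.pi * η ^ 2))
  have hπ := Real.pi_pos
  have hN0 : (0 : ℝ) < N := lt_trans (by positivity) hN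
  set ε : ℝ := Real.sqrt ((|T| + 1) / (Real.pi * N)) with hε
  have hεsq : ε ^ 2 * (N * (2 * Real.pi)) / 2 = |T| + 1 := by
    rw [hε, Real.sq_sqrt (by positivity)]
    field_simp
  have hεη : ε ≤ η := by
    rw [hε]
    refine Real.sqrt_le_iff.2 ⟨hη0.le, ?_⟩
    rw [div_lt_iff₀ (by positivity)] at hN
    rw [div_le_iff₀ (by positivity)]
    nlinarith
  have hε0 : 0 ≤ ε := Real.sqrt_nonneg _
  have hεM : ε * M < min 1 δ := (mul_le_mul_of_nonneg_right hεη hM0).trans_lt hηM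
  set κ : ℝ := N * (2 * Real.pi) with hκ
  have hspiral := fun t => hM ⟨ε, hε0⟩ (show ε ≤ 1 from hεη.trans hη1) κ t
  have hc : (⟨ε, hε0⟩ * M : ℝ≥0) < 1 := hεM.trans_le (min_le_left _ _)
  have hsm := contDiff_spiral (e := e) (ℓ := ℓ) (σ := σ) (ε := ε) (κ := κ) (χ := χ) χ.contDiff
  choose Θ hΘ using fun t => exists_diffeomorph_id_add
    (hsm.comp (contDiff_const.prodMk contDiff_id : ContDiff ℝ ∞ fun x : JetSpace n => (t, x)))
    hc (hspiral t).1
  replace hΘ : ∀ t x, Θ t x = x + spiral e ℓ χ σ ε κ t x := hΘ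
  have hdisp : ∀ t x, dist (Θ t x) x < min 1 δ := fun t x => by
    rw [hΘ, dist_eq_norm, add_sub_cancel_left]
    exact ((hspiral t).2 x).trans_lt hεM
  have hχ0 : ∀ x, x ∉ Metric.closedBall (0 : JetSpace n) (R + 1) → χ x = 0 := fun x hx =>
    χ.zero_of_le_dist (not_le.1 hx).le
  refine ⟨Θ, ?_, ?_, ?_, ⟨Metric.closedBall 0 (R + 1), isCompact_closedBall _ _, ?_⟩, ?_⟩
  · simp only [hΘ]
    exact contDiff_snd.add hsm
  · intro x
    rw [hΘ, spiral_int_mul_two_pi (N := 0) (by simp), add_zero]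
  · intro x
    rw [hΘ, spiral_int_mul_two_pi (N := N) (by simp [hκ]), add_zero]
  · intro t x hx
    rw [hΘ, spiral_eq_zero (hχ0 x hx), add_zero]
  · intro x hx t ht
    have hd : HasDerivAt (fun s => Θ s x) (deriv (fun s => spiral e ℓ χ σ ε κ s x) t) t := by
      simp only [hΘ]
      exact (hasDerivAt_spiral x).differentiableAt.hasDerivAt.const_add x
    rw [(hφ.hasDerivWithinAt ht hd).derivWithin (uniqueDiffOn_Icc zero_lt_one t ht)]
    have hsplit : ∀ v : JetSpace n, ((1, v) : ℝ × JetSpace n) = (1, 0) + (0, v) := by simp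
    rw [hsplit, map_add, map_add, hφ.contactForm_pathDeriv_inr ht, hΘ t x,
      contactForm_deriv_spiral hℓ, ← hΘ t x, hεsq]
    have hgp := hg (t, Θ t x) ⟨ht, mem_univ _⟩
    change 0 < pathHamiltonian φ (t, Θ t x) + _
    -- Where `χ = 1`, the speed `|T| + 1` beats `H / (σ g) ≥ -|T|`; on the shell `H` stays positive
    -- and the loop adds a nonnegative term; outside, the loop is constant.
    by_cases hx1 : x ∈ Metric.closedBall (0 : JetSpace n) (R + 1)
    · by_cases hx2 : x ∈ Metric.ball (0 : JetSpace n) R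
      · have hb := hT (t, Θ t x) ⟨ht, by
          rw [Metric.mem_closedBall] at hx1 ⊢
          have := (hdisp t x).trans_le (min_le_left _ _)
          linarith [dist_triangle (Θ t x) x 0]⟩
        rw [χ.one_of_mem_closedBall (Metric.ball_subset_closedBall hx2)]
        rw [Real.norm_eq_abs] at hb
        have h1 := (abs_le.1 (hb.trans (le_abs_self T))).1
        rw [le_div_iff₀ hgp] at h1
        nlinarith
      · have h1 : 0 < pathHamiltonian φ (clamp (t, Θ t x)) := by
          apply hδ'
          rw [Metric.mem_thickening_iff]
          refine ⟨(t, x), ⟨ht, hx, hx1, hx2⟩, ?_⟩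
          rw [Prod.dist_eq]
          simpa using ((hdisp t x).trans_le (min_le_right _ _))
        rw [hclamp' t ht] at h1
        have h2 : 0 ≤ σ * conformalFactor φ (t, Θ t x) * ((|T| + 1) * χ x ^ 2) := by positivity
        linarith
    · rw [hχ0 x hx1, hΘ t x, spiral_eq_zero (hχ0 x hx1), add_zero]
      have := hpos x hx (fun hxK => hx1 (Metric.ball_subset_closedBall.trans
        (Metric.closedBall_subset_closedBall (by linarith)) (hR hxK))) t ht
      simpa using this

end IsContactPath

end JetSpace

/-! ### Assembly of the positive isotopy. -/

theorem mainTheorem9 {n : ℕ} (hn : 1 ≤ n)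
    {L : Type*} [TopologicalSpace L] [T2Space L] [SecondCountableTopology L]
    [ChartedSpace (EuclideanSpace ℝ (Fin n)) L] [IsManifold (𝓡 n) ∞ L]
    (ι : ℝ → L → JetSpace n)
    (hι : JetSpace.IsLegendrianIsotopy ι)
    (hcont : JetSpace.IsInducedByContactPath ι)
    (hpos : ∃ K : Set L, IsCompact K ∧ ∀ p ∉ K, JetSpace.PositiveAt ι p) :
    ∃ ι' : ℝ → L → JetSpace n,
      JetSpace.IsIsotopy ι' ∧
      (∀ p, JetSpace.PositiveAt ι' p) ∧
      ι' 0 = ι 0 ∧ ι' 1 = ι 1 ∧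
      ∃ K' : Set L, IsCompact K' ∧ ∀ p ∉ K', ∀ t ∈ Icc (0 : ℝ) 1, ι' t p = ι t p := by
  obtain ⟨φ, hφ, hφι⟩ := hcont
  obtain ⟨K, hK, hKpos⟩ := hpos
  have h0 : (0 : ℝ) ∈ Icc (0 : ℝ) 1 := by simp
  have h1 : (1 : ℝ) ∈ Icc (0 : ℝ) 1 := by simp
  have hemb := hι.embedding 0 h0
  obtain ⟨Θ, hΘ, hΘ0, hΘ1, ⟨C, hC, hΘC⟩, hΘpos⟩ := hφ.exists_loop hn (A := range (ι 0))
    (K := ι 0 '' K) (hι.proper 0 h0) (hK.image hemb.isEmbedding.continuous) (by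
      rintro _ ⟨p, rfl⟩ hp t ht
      have h := hKpos p (fun hpK => hp ⟨p, hpK, rfl⟩) t ht
      rw [derivWithin_congr (fun s hs => hφι s hs p) (hφι t ht p),
        (hφ.hasDerivWithinAt ht (hasDerivAt_const t (ι 0 p))).derivWithin
          (uniqueDiffOn_Icc zero_lt_one t ht), hφι t ht p] at h
      exact h)
  refine ⟨fun t p => φ t (Θ t (ι 0 p)), ⟨?_, ?_, ?_⟩, ?_, ?_, ?_, ι 0 ⁻¹' C, ?_, ?_⟩
  · have hs : ContMDiff ((𝓡 n).prod 𝓘(ℝ, ℝ)) (𝓘(ℝ, ℝ).prod 𝓘(ℝ, JetSpace n)) ∞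
        (fun x : L × ℝ => (x.2, ι 0 x.1)) :=
      contMDiff_snd.prodMk (hemb.contMDiff.comp contMDiff_fst)
    have hs' : ContMDiff ((𝓡 n).prod 𝓘(ℝ, ℝ)) 𝓘(ℝ, ℝ × JetSpace n) ∞
        (fun x : L × ℝ => (x.2, ι 0 x.1)) := by
      rwa [modelWithCornersSelf_prod, ← chartedSpaceSelf_prod]
    exact hφ.smooth.contMDiffOn.comp
      ((contDiff_fst.prodMk hΘ).contMDiff.comp hs').contMDiffOn (fun x hx => ⟨hx.2, mem_univ _⟩)
  · exact fun t _ => hemb.diffeomorph_comp ((Θ t).trans (φ t))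
  · intro t _ D hD
    let Φ := ((Θ t).trans (φ t)).toHomeomorph
    -- Properness at time `t` is carried over from `ι 0` by the homeomorphism `Φ`.
    have : range (fun p => φ t (Θ t (ι 0 p))) ∩ D = Φ '' (range (ι 0) ∩ Φ ⁻¹' D) := by
      rw [image_inter_preimage, ← range_comp]
      rfl
    rw [this]
    exact (hι.proper 0 h0 _ (Φ.isCompact_preimage.2 hD)).image Φ.continuous
  · exact fun p t ht => hΘpos _ ⟨p, rfl⟩ t ht
  · ext1 p
    dsimp only
    rw [hΘ0, ← hφι 0 h0]
  · ext1 p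
    dsimp only
    rw [hΘ1, ← hφι 1 h1]
  · rw [hemb.isEmbedding.isCompact_iff, image_preimage_eq_inter_range, inter_comm]
    exact hι.proper 0 h0 C hC
  · intro p hp t ht
    dsimp only
    rw [hΘC t _ hp, ← hφι t ht]
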